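/- Call a real $n\times n$ matrix row substochastic if its entries are nonnegative and all its row sums are at most $1$, and doubly substochastic if, in addition, all its column sums are at most $1$. Let $I$ be the $n\times n$ identity matrix, let $\operatorname{per}$ denote the permanent, and let $\sigma(A)$ denote the sum of all entries of $A$. Theorem. Let $s$ be a real number with $0\le s\le n$, and let $e$ be the greatest even integer less than or equal to $s$. Suppose that either $n$ is even, or $n$ is odd and $s\le n-1$. Then $$\max\{\operatorname{per}(I-A) : A \text{ is an } n\times n \text{ row substochastic matrix with } \sigma(A)=s\}=2^{e/2}\left[1+\left(\frac{s-e}{2}\right)^2\right].$$ Moreover, the maximum is attained at the doubly substochastic block-diagonal matrix with $\sigma(\tilde A)=s$ $$\tilde A=\underbrace{M_2\oplus\cdots\oplus M_2}_{e/2}\oplus S_2\oplus \mathbf 0_{n-e-2},\qquad M_2=\begin{pmatrix}0&1\\1&0\end{pmatrix},\quad S_2=\begin{pmatrix}0&\frac{s-e}{2}\\ \frac{s-e}{2}&0\end{pmatrix},$$ where $\mathbf 0_m$ is the $m\times m$ zero matrix; if $e\ge n-1$ (in which case $s=e$), $S_2\oplus\mathbf 0_{n-e-2}$ is replaced by $\mathbf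 0_{n-e}$, which is absent when $e=n$. -/

import Mathlib

/-- An `n × n` row substochastic matrix: nonnegative entries, all row sums at most one. -/
def RowSubstochastic {n : ℕ} (A : Matrix (Fin n) (Fin n) ℝ) : Prop :=
  (∀ i j, 0 ≤ A i j) ∧ ∀ i, ∑ j, A i j ≤ 1

/-- An `n × n` doubly substochastic matrix: nonnegative entries, all row sums and all column sums
at most one. -/
def DoublySubstochastic {n : ℕ} (A : Matrix (Fin n) (Fin n) ℝ) : Prop :=
  (∀ i j, 0 ≤ A i j) ∧ (∀ i, ∑ j, A i j ≤ 1) ∧ ∀ j, ∑ i, A i j ≤ 1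

/-- The sum `σ(A)` of all entries of a matrix. -/
def entrySum {n : ℕ} (A : Matrix (Fin n) (Fin n) ℝ) : ℝ :=
  ∑ i, ∑ j, A i j

/-- The set of all `n × n` row substochastic matrices with total sum `s`. -/
def rowSubstochasticWithSum (n : ℕ) (s : ℝ) : Set (Matrix (Fin n) (Fin n) ℝ) :=
  {A | RowSubstochastic A ∧ entrySum A = s}

/-- The set of all `n × n` doubly substochastic matrices with total sum `s`. -/
def doublySubstochasticWithSum (n : ℕ) (s : ℝ) : Set (Matrix (Fin n) (Fin n) ℝ) :=
  {A | DoublySubstochastic A ∧ entrySum A = s}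

/-- The `2 × 2` diagonal blocks, numbered from `0`: `e / 2` copies of `[0, 1; 1, 0]`, then one
block `[0, (s - e) / 2; (s - e) / 2, 0]`, then zero blocks. -/
noncomputable def extremalBlock (s : ℝ) (e k : ℕ) : Matrix (Fin 2) (Fin 2) ℝ :=
  if k < e / 2 then !![0, 1; 1, 0]
  else if k = e / 2 then !![0, (s - e) / 2; (s - e) / 2, 0]
  else 0

/-- The `n × n` block-diagonal matrix `M ⊕ ⋯ ⊕ M ⊕ S ⊕ 0` with `e / 2` copies of
`M = [0, 1; 1, 0]`, one block `S = [0, (s - e) / 2; (s - e) / 2, 0]`, and zeros elsewhere.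
Row `i` (numbered from `0`) lies in block `i / 2`, at position `i % 2`. Only the blocks that fit
into an `n × n` matrix appear; if `n` is odd, the last diagonal entry is a `1 × 1` zero block. -/
noncomputable def extremalMatrix (n : ℕ) (s : ℝ) (e : ℕ) : Matrix (Fin n) (Fin n) ℝ :=
  Matrix.of fun i j =>
    if i.val / 2 = j.val / 2 then
      extremalBlock s e (i.val / 2) (Fin.ofNat 2 i.val) (Fin.ofNat 2 j.val)
    else 0

/-! Write row `i` of `A` as `r i` times a probability vector. The permanent is affine in each row,
so `per (I - A)` is a weighted average of the values `per (I - A_f)`, where `A_f` has the single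
entry `r i` in row `i`, at column `f i` (`permanent_one_sub_eq_sum`). Expanding `per (I - A_f)`
gives a sum over the sets permuted by `f`, which factors over the cycles `O` of `f` as `∏ (1 + ∏ i ∈
O, -r i)`. An odd cycle gives a factor at most 1. By AM-GM, an even one gives at most `1 + u ^ 2`,
where `u ≤ 1` is at most half the weight of `O`. Combining factors with `floorBound_mul_le` bounds
everything by `floorBound (s / 2)`, and `⌊s / 2⌋ = e / 2`. Equality holds when the cycles are
2-cycles with weights as concentrated as possible. -/

section Substochastic

open Finset

/-! ### Combining factors `1 + u ^ 2` with `u` in `[0, 1]`. -/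

section Growth

/-- The bound `2 ^ ⌊t⌋ * (1 + (t - ⌊t⌋) ^ 2)`. -/
noncomputable def floorBound (t : ℝ) : ℝ :=
  2 ^ ⌊t⌋₊ * (1 + (t - ⌊t⌋₊) ^ 2)

theorem floorBound_nonneg (t : ℝ) : 0 ≤ floorBound t := by
  unfold floorBound; positivity

theorem floorBound_mul_le {t u : ℝ} (ht : 0 ≤ t) (hu : 0 ≤ u) (hu1 : u ≤ 1) :
    floorBound t * (1 + u ^ 2) ≤ floorBound (t + u) := by
  have h1 := Nat.floor_le ht
  have h2 := Nat.lt_floor_add_one t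
  set m := ⌊t⌋₊ with hm
  have hx : 0 ≤ t - m := by linarith
  rcases lt_or_ge (t + u) (m + 1) with h | h
  · have hf : ⌊t + u⌋₊ = m := by
      rw [Nat.floor_eq_iff (by linarith)]
      exact ⟨by linarith, h⟩
    unfold floorBound
    rw [hf, ← hm, mul_assoc]
    refine mul_le_mul_of_nonneg_left ?_ (by positivity)
    -- With `x = t - m`, the claim reduces to `(x * u) ^ 2 ≤ 2 * (x * u)`.
    have h0 : 0 ≤ (t - m) * u := mul_nonneg hx hu
    have h3 : (t - m) * u ≤ 1 := mul_le_one₀ (by linarith) hu hu1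
    nlinarith [mul_nonneg h0 (sub_nonneg.2 h3)]
  · have hf : ⌊t + u⌋₊ = m + 1 := by
      rw [Nat.floor_eq_iff (by linarith)]
      push_cast
      exact ⟨h, by linarith⟩
    unfold floorBound
    rw [hf, ← hm, mul_assoc, pow_succ (2 : ℝ) m, mul_assoc]
    refine mul_le_mul_of_nonneg_left ?_ (by positivity)
    push_cast
    -- In terms of the deficits `a` and `b` from 1, the right side minus the left is exactly the
    -- expression in `key`.
    obtain ⟨a, ha⟩ : ∃ a, a = 1 - (t - m) := ⟨_, rfl⟩
    obtain ⟨b, hb⟩ : ∃ b, b = 1 - u := ⟨_, rfl⟩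
    have ha0 : 0 ≤ a := by linarith
    have hb0 : 0 ≤ b := by linarith
    have hb1 : b ≤ 1 := by linarith
    have hu' : u = 1 - b := by linarith
    have ht' : t = 1 - a + m := by linarith
    have key : 0 ≤ a * b * (a * (2 - b) + 2 * b) := by
      have : 0 ≤ 2 - b := by linarith
      positivity
    rw [hu', ht']
    nlinarith [key]

theorem floorBound_mono {t u : ℝ} (ht : 0 ≤ t) (htu : t ≤ u) : floorBound t ≤ floorBound u := by
  have h1 := Nat.floor_le ht
  rcases (Nat.floor_mono htu).eq_or_lt with h | h
  · unfold floorBound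
    rw [← h]
    gcongr
  · have h2 := Nat.lt_floor_add_one t
    have h3 : (t - ⌊t⌋₊) ^ 2 ≤ 1 := pow_le_one₀ (by linarith) (by linarith)
    calc floorBound t ≤ 2 ^ ⌊t⌋₊ * 2 := by
          unfold floorBound
          gcongr
          linarith
      _ = 2 ^ (⌊t⌋₊ + 1) := (pow_succ _ _).symm
      _ ≤ 2 ^ ⌊u⌋₊ := pow_le_pow_right₀ one_le_two h
      _ ≤ floorBound u := le_mul_of_one_le_right (by positivity) (by nlinarith [sq_nonneg (u - ⌊u⌋₊)])

theorem one_le_floorBound {t : ℝ} (ht : 0 ≤ t) : 1 ≤ floorBound t := by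
  simpa [floorBound] using floorBound_mono le_rfl ht

end Growth

/-! ### Sums over invariant sets and their factorization over cycles. -/

section InvariantSums

variable {ι : Type*} [DecidableEq ι]

/-- The sum, over all subsets `T` of `S` with `f '' T = T`, of `∏ i ∈ T, -r i`. -/
def invariantSum (f : ι → ι) (r : ι → ℝ) (S : Finset ι) : ℝ :=
  ∑ T ∈ S.powerset with T.image f = T, ∏ i ∈ T, -r i

/-- A map of the finite set `T ∪ O` onto itself is injective there, so images commute with
intersection and difference. -/
theorem image_inter_eq {f : ι → ι} {T O : Finset ι} (hT : T.image f = T) (hO : O.image f = O) :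
    (T ∩ O).image f = T ∩ O ∧ (T \ O).image f = T \ O := by
  have hU : (T ∪ O).image f = T ∪ O := by rw [image_union, hT, hO]
  have hinj : Set.InjOn f (T ∪ O : Finset ι) := by
    rw [← card_image_iff, hU]
  have h1 : (T ∩ O).image f = T ∩ O := by
    rw [image_inter_of_injOn _ _ (by simpa using hinj), hT, hO]
  refine ⟨h1, ?_⟩
  have h2 : (T \ (T ∩ O)).image f = T.image f \ (T ∩ O).image f :=
    image_sdiff_of_injOn (hinj.mono (by simp)) inter_subset_left
  rwa [h1, hT, sdiff_inter_self_left] at h2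

/-- A minimal invariant set `O` is a cycle: every invariant `T` either misses it or contains it, and
`T \ O` is again invariant. -/
theorem invariantSum_eq_mul {f : ι → ι} {r : ι → ℝ} {S O : Finset ι} (hOS : O ⊆ S)
    (hO : O.image f = O) (hne : O.Nonempty)
    (hmin : ∀ T ⊆ O, T.Nonempty → T.image f = T → T = O) :
    invariantSum f r S = invariantSum f r (S \ O) * (1 + ∏ i ∈ O, -r i) := by
  have hsplit : S.powerset.filter (fun T => T.image f = T) =
      ((S \ O).powerset.filter (fun T => T.image f = T)) ∪
        ((S \ O).powerset.filter (fun T => T.image f = T)).image (fun T => T ∪ O) := by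
    ext T
    simp only [mem_filter, mem_powerset, mem_union, mem_image]
    constructor
    · rintro ⟨hTS, hT⟩
      obtain ⟨h1, h2⟩ := image_inter_eq hT hO
      rcases (T ∩ O).eq_empty_or_nonempty with h | h
      · left
        exact ⟨subset_sdiff.2 ⟨hTS, disjoint_iff_inter_eq_empty.2 h⟩, hT⟩
      · right
        have h3 := hmin _ inter_subset_right h h1
        exact ⟨T \ O, ⟨sdiff_subset_sdiff hTS subset_rfl, h2⟩,
          sdiff_union_of_subset (inter_eq_right.1 h3)⟩
    · rintro (⟨h1, h2⟩ | ⟨U, ⟨h1, h2⟩, rfl⟩)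
      · exact ⟨h1.trans sdiff_subset, h2⟩
      · exact ⟨union_subset (h1.trans sdiff_subset) hOS, by rw [image_union, h2, hO]⟩
  have hdis : ∀ T ∈ (S \ O).powerset.filter (fun T => T.image f = T), Disjoint T O := by
    intro T hT
    exact (subset_sdiff.1 (mem_powerset.1 (mem_filter.1 hT).1)).2
  unfold invariantSum
  rw [hsplit, sum_union, sum_image, mul_add, mul_one, sum_mul]
  · congr 1
    exact sum_congr rfl fun T hT => prod_union (hdis T hT)
  · intro T hT U hU hTU
    have h1 := union_sdiff_cancel_right (hdis T hT)
    have h2 := union_sdiff_cancel_right (hdis U hU)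
    rw [← h1, ← h2]
    exact congrArg (· \ O) hTU
  · rw [disjoint_left]
    rintro T hT hT'
    obtain ⟨U, -, rfl⟩ := mem_image.1 hT'
    obtain ⟨x, hx⟩ := hne
    exact disjoint_left.1 (hdis _ hT) (mem_union_right _ hx) hx

theorem prod_neg_le_sq {r : ι → ℝ} {O : Finset ι} (hne : O.Nonempty) (h0 : ∀ i, 0 ≤ r i)
    (h1 : ∀ i, r i ≤ 1) :
    0 ≤ 1 + ∏ i ∈ O, -r i ∧
      ∃ u, 0 ≤ u ∧ u ≤ 1 ∧ u ≤ (∑ i ∈ O, r i) / 2 ∧ 1 + ∏ i ∈ O, -r i ≤ 1 + u ^ 2 := by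
  have hp0 : 0 ≤ ∏ i ∈ O, r i := prod_nonneg fun i _ => h0 i
  have hp1 : ∏ i ∈ O, r i ≤ 1 := prod_le_one (fun i _ => h0 i) fun i _ => h1 i
  have hs0 : 0 ≤ ∑ i ∈ O, r i := sum_nonneg fun i _ => h0 i
  rw [prod_neg]
  rcases Nat.even_or_odd O.card with hc | hc
  · rw [hc.neg_one_pow, one_mul]
    refine ⟨by linarith, ?_⟩
    have hcard : 1 < O.card := by
      have := hne.card_pos
      obtain ⟨k, hk⟩ := hc
      omega
    obtain ⟨a, ha, b, hb, hab⟩ := one_lt_card.1 hcard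
    have hsub : ({a, b} : Finset ι) ⊆ O := by
      intro x hx
      rcases mem_insert.1 hx with rfl | hx
      · exact ha
      · rwa [mem_singleton.1 hx]
    -- Two elements suffice: the other factors are at most 1, and AM-GM bounds `r a * r b`.
    refine ⟨(r a + r b) / 2, by linarith [h0 a, h0 b], by linarith [h1 a, h1 b], ?_, ?_⟩
    · have := sum_le_sum_of_subset_of_nonneg hsub fun i _ _ => h0 i
      rw [sum_pair hab] at this
      linarith
    · have h2 : ∏ i ∈ O, r i ≤ ∏ i ∈ ({a, b} : Finset ι), r i := by
        rw [← prod_sdiff hsub]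
        exact mul_le_of_le_one_left (prod_nonneg fun i _ => h0 i)
          (prod_le_one (fun i _ => h0 i) fun i _ => h1 i)
      rw [prod_pair hab] at h2
      nlinarith [sq_nonneg (r a - r b)]
  · rw [hc.neg_one_pow]
    exact ⟨by linarith, 0, le_rfl, zero_le_one, by linarith, by linarith⟩

theorem invariantSum_le_floorBound (f : ι → ι) {r : ι → ℝ} (h0 : ∀ i, 0 ≤ r i)
    (h1 : ∀ i, r i ≤ 1) (S : Finset ι) :
    0 ≤ invariantSum f r S ∧ invariantSum f r S ≤ floorBound ((∑ i ∈ S, r i) / 2) := by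
  induction S using Finset.strongInduction with
  | H S ih =>
    by_cases hex : ((S.powerset.filter (fun T => T.image f = T)).filter Finset.Nonempty).Nonempty
    · obtain ⟨O, hO, hmin⟩ := exists_min_image _ Finset.card hex
      simp only [mem_filter, mem_powerset] at hO hmin
      obtain ⟨⟨hOS, hOf⟩, hne⟩ := hO
      have hmul := invariantSum_eq_mul (r := r) hOS hOf hne fun T hT hTne hTf =>
        eq_of_subset_of_card_le hT (hmin T ⟨⟨hT.trans hOS, hTf⟩, hTne⟩)
      obtain ⟨ih0, ih1⟩ := ih (S \ O) (sdiff_ssubset hOS hne)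
      obtain ⟨hp, u, hu0, hu1, hus, hpu⟩ := prod_neg_le_sq hne h0 h1
      have hs : 0 ≤ ∑ i ∈ S \ O, r i := sum_nonneg fun i _ => h0 i
      have hsum := sum_sdiff (f := r) hOS
      rw [hmul]
      refine ⟨mul_nonneg ih0 hp, ?_⟩
      calc _ ≤ floorBound ((∑ i ∈ S \ O, r i) / 2) * (1 + u ^ 2) :=
            mul_le_mul ih1 hpu hp (floorBound_nonneg _)
        _ ≤ floorBound ((∑ i ∈ S \ O, r i) / 2 + u) :=
            floorBound_mul_le (by linarith) hu0 hu1
        _ ≤ _ := floorBound_mono (by linarith) (by linarith)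
    · have hset : S.powerset.filter (fun T => T.image f = T) = {∅} := by
        ext T
        constructor
        · intro hT
          rcases T.eq_empty_or_nonempty with h | h
          · simp [h]
          · exact absurd ⟨T, mem_filter.2 ⟨hT, h⟩⟩ hex
        · intro hT
          simp [mem_singleton.1 hT]
      have : invariantSum f r S = 1 := by simp [invariantSum, hset]
      rw [this]
      have hs : 0 ≤ ∑ i ∈ S, r i := sum_nonneg fun i _ => h0 i
      exact ⟨zero_le_one, one_le_floorBound (by linarith)⟩

end InvariantSums

/-! ### Reduction of the permanent to matrices with one entry per row. -/

section Permanent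

variable {ι : Type*} [DecidableEq ι] [Fintype ι]

/-- The matrix whose row `i` is `r i` times the unit vector at `f i`. -/
def functionMatrix (f : ι → ι) (r : ι → ℝ) : Matrix ι ι ℝ :=
  Matrix.of fun i j => if f i = j then r i else 0

theorem permanent_eq_sum_prod_row (M : Matrix ι ι ℝ) :
    M.permanent = ∑ σ : Equiv.Perm ι, ∏ i, M i (σ i) := by
  rw [← Matrix.permanent_transpose]
  rfl

/-- Only a permutation equal to `f` on `T` and to the identity elsewhere contributes; it exists
exactly when `f` permutes `T`, and is then unique. -/
theorem sum_perm_agreeing (f : ι → ι) (r : ι → ℝ) (T : Finset ι) :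
    ∑ σ : Equiv.Perm ι, (∏ i ∈ T, (if f i = σ i then -r i else 0)) *
        ∏ i ∈ univ \ T, (if i = σ i then (1 : ℝ) else 0) =
      if T.image f = T then ∏ i ∈ T, -r i else 0 := by
  split_ifs with hT
  · have hmaps : ∀ i ∈ T, f i ∈ T := fun i hi => hT ▸ mem_image_of_mem f hi
    have hinj : Set.InjOn f T := by rw [← card_image_iff, hT]
    have hbij : Function.Bijective (fun i => if i ∈ T then f i else i) := by
      rw [← Finite.injective_iff_bijective]
      intro i j hij
      by_cases hi : i ∈ T <;> by_cases hj : j ∈ T <;> simp only [hi, hj, if_true, if_false] at hij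
      · exact hinj hi hj hij
      · exact absurd (hij ▸ hmaps i hi) hj
      · exact absurd (hij ▸ hmaps j hj) hi
      · exact hij
    rw [sum_eq_single (Equiv.ofBijective _ hbij)]
    · rw [prod_congr rfl (g := fun i => -r i), prod_eq_one (s := univ \ T), mul_one]
      · intro i hi
        simp [(mem_sdiff.1 hi).2]
      · intro i hi
        simp [hi]
    · intro σ _ hσ
      by_contra hne
      obtain ⟨ha, hb⟩ := mul_ne_zero_iff.1 hne
      rw [prod_ne_zero_iff] at ha hb
      apply hσ
      ext i
      by_cases hi : i ∈ T
      · have := ha i hi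
        simp only [Equiv.ofBijective_apply, hi, if_true]
        by_contra h
        exact this (if_neg fun h' => h h'.symm)
      · have := hb i (by simp [hi])
        simp only [Equiv.ofBijective_apply, hi, if_false]
        by_contra h
        exact this (if_neg fun h' => h h'.symm)
    · simp
  · refine sum_eq_zero fun σ _ => ?_
    by_contra hne
    obtain ⟨ha, hb⟩ := mul_ne_zero_iff.1 hne
    rw [prod_ne_zero_iff] at ha hb
    have hb' : ∀ i ∉ T, i = σ i := fun i hi => by
      by_contra h
      exact hb i (by simp [hi]) (if_neg h)
    have ha' : ∀ i ∈ T, f i = σ i := fun i hi => by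
      by_contra h
      exact ha i hi (if_neg h)
    apply hT
    rw [image_congr (g := σ) fun i hi => ha' i hi]
    refine eq_of_subset_of_card_le ?_ (card_image_of_injective _ σ.injective).ge
    intro j hj
    obtain ⟨i, hi, rfl⟩ := mem_image.1 hj
    by_contra h
    have := σ.injective (hb' _ h)
    exact h (this ▸ hi)

theorem permanent_one_sub_functionMatrix (f : ι → ι) (r : ι → ℝ) :
    (1 - functionMatrix f r).permanent = invariantSum f r univ := by
  rw [permanent_eq_sum_prod_row]
  have hentry : ∀ (σ : Equiv.Perm ι) (i : ι), (1 - functionMatrix f r) i (σ i) =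
      (if f i = σ i then -r i else 0) + (if i = σ i then (1 : ℝ) else 0) := by
    intro σ i
    simp only [functionMatrix, Matrix.sub_apply, Matrix.one_apply, Matrix.of_apply]
    split_ifs <;> ring
  simp_rw [hentry, prod_add]
  rw [sum_comm, invariantSum, sum_filter]
  exact sum_congr rfl fun T _ => sum_perm_agreeing f r T

/-- `per (I - A)` is the average of `per (I - A_f)` where `A_f` has the same row sums as `A` and
one nonzero entry in each row, if row `i` of `A` is `r i` times the probability vector `p i`. -/
theorem permanent_one_sub_eq_sum {A : Matrix ι ι ℝ} {r : ι → ℝ} {p : ι → ι → ℝ}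
    (hA : ∀ i j, A i j = r i * p i j) (hp : ∀ i, ∑ j, p i j = 1) :
    (1 - A).permanent =
      ∑ f : ι → ι, (∏ i, p i (f i)) * (1 - functionMatrix f r).permanent := by
  simp_rw [permanent_eq_sum_prod_row, mul_sum]
  rw [sum_comm]
  refine sum_congr rfl fun σ _ => ?_
  have hentry : ∀ i, (1 - A) i (σ i) =
      ∑ j, p i j * ((1 : Matrix ι ι ℝ) i (σ i) - if j = σ i then r i else 0) := by
    intro i
    simp_rw [mul_sub, sum_sub_distrib, ← sum_mul, hp]
    simp [hA, mul_comm]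
  simp_rw [hentry, Finset.prod_univ_sum, Fintype.piFinset_univ, ← prod_mul_distrib]
  rfl

theorem permanent_one_sub_le_floorBound {A : Matrix ι ι ℝ} (h0 : ∀ i j, 0 ≤ A i j)
    (h1 : ∀ i, ∑ j, A i j ≤ 1) :
    (1 - A).permanent ≤ floorBound ((∑ i, ∑ j, A i j) / 2) := by
  have hr0 : ∀ i, 0 ≤ ∑ j, A i j := fun i => sum_nonneg fun j _ => h0 i j
  have hex : ∀ i, ∃ q : ι → ℝ, (∀ j, 0 ≤ q j) ∧ ∑ j, q j = 1 ∧
      ∀ j, A i j = (∑ j, A i j) * q j := by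
    intro i
    rcases (hr0 i).eq_or_lt with h | h
    -- For a zero row any probability vector will do.
    · refine ⟨Pi.single i 1, fun j => ?_, by simp, fun j => ?_⟩
      · exact (Pi.single_nonneg.2 zero_le_one : (0 : ι → ℝ) ≤ Pi.single i 1) j
      · rw [← h, zero_mul]
        exact (sum_eq_zero_iff_of_nonneg fun j _ => h0 i j).1 h.symm j (mem_univ j)
    · refine ⟨fun j => A i j / ∑ j, A i j, fun j => div_nonneg (h0 i j) h.le, ?_, fun j => ?_⟩
      · rw [← sum_div, div_self h.ne']
      · field_simp
  choose p hp0 hp1 hAp using hex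
  rw [permanent_one_sub_eq_sum hAp hp1]
  have hone : ∑ f : ι → ι, ∏ i, p i (f i) = 1 := by
    have := Finset.prod_univ_sum (fun _ : ι => (univ : Finset ι)) p
    rw [Fintype.piFinset_univ] at this
    rw [← this]
    exact prod_eq_one fun i _ => hp1 i
  calc _ ≤ ∑ f : ι → ι, (∏ i, p i (f i)) * floorBound ((∑ i, ∑ j, A i j) / 2) := by
        refine sum_le_sum fun f _ => mul_le_mul_of_nonneg_left ?_ (prod_nonneg fun i _ => hp0 i _)
        rw [permanent_one_sub_functionMatrix]
        exact (invariantSum_le_floorBound f hr0 h1 univ).2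
    _ = _ := by rw [← sum_mul, hone, one_mul]

end Permanent

/-! ### The extremal matrix, its entry sum and its permanent. -/

section Extremal

/-- Exchange `2 * k` and `2 * k + 1`; if `n` is odd, the last index is fixed. -/
def swapPair {n : ℕ} (i : Fin n) : Fin n :=
  ⟨if i.val % 2 = 1 then i.val - 1 else if i.val + 1 < n then i.val + 1 else i.val, by
    have := i.isLt
    split_ifs <;> omega⟩

theorem swapPair_swapPair {n : ℕ} (i : Fin n) : swapPair (swapPair i) = i := by
  have := i.isLt
  ext
  simp only [swapPair]
  split_ifs <;> omega

/-- The off-diagonal entry of the `k`-th block of the extremal matrix. -/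
noncomputable def blockWeight (s : ℝ) (e k : ℕ) : ℝ :=
  if k < e / 2 then 1 else if k = e / 2 then (s - e) / 2 else 0

theorem extremalBlock_apply (s : ℝ) (e k : ℕ) (a b : Fin 2) :
    extremalBlock s e k a b = if a = b then 0 else blockWeight s e k := by
  unfold extremalBlock blockWeight
  split_ifs <;> fin_cases a <;> fin_cases b <;> simp_all

/-- For odd `n`, `swapPair` fixes the last index and would put its weight on the diagonal, where the
extremal matrix has 0; `hw` rules out the conflict. -/
theorem extremalMatrix_eq {n : ℕ} {s : ℝ} {e : ℕ} (hw : Odd n → blockWeight s e (n / 2) = 0) :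
    extremalMatrix n s e = functionMatrix swapPair fun i => blockWeight s e (i.val / 2) := by
  ext i j
  have hi := i.isLt
  have hj := j.isLt
  have hmod : (Fin.ofNat 2 i.val = Fin.ofNat 2 j.val) ↔ i.val % 2 = j.val % 2 := by
    simp [Fin.ext_iff]
  simp only [extremalMatrix, functionMatrix, Matrix.of_apply, extremalBlock_apply, hmod]
  by_cases hlast : i.val % 2 = 0 ∧ i.val + 1 = n
  · have h0 : blockWeight s e (i.val / 2) = 0 := by
      have := hw (by rw [Nat.odd_iff]; omega)
      rwa [show i.val / 2 = n / 2 by omega]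
    simp [h0]
  · have hiff : swapPair i = j ↔ i.val / 2 = j.val / 2 ∧ ¬ i.val % 2 = j.val % 2 := by
      simp only [Fin.ext_iff, swapPair]
      split_ifs <;> omega
    simp only [hiff]
    split_ifs <;> simp_all

theorem sum_range_div_two (w : ℕ → ℝ) (m : ℕ) :
    ∑ i ∈ range (2 * m), w (i / 2) = 2 * ∑ k ∈ range m, w k := by
  induction m with
  | zero => simp
  | succ m ih =>
    rw [show 2 * (m + 1) = 2 * m + 1 + 1 by ring, sum_range_succ, sum_range_succ, ih,
      sum_range_succ, show 2 * m / 2 = m by omega, show (2 * m + 1) / 2 = m by omega]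
    ring

theorem sum_fin_div_two {n : ℕ} {w : ℕ → ℝ} (hw : Odd n → w (n / 2) = 0) :
    ∑ i : Fin n, w (i.val / 2) = 2 * ∑ k ∈ range ((n + 1) / 2), w k := by
  rw [Fin.sum_univ_eq_sum_range (fun i => w (i / 2)) n]
  rcases Nat.even_or_odd' n with ⟨m, rfl | rfl⟩
  · rw [sum_range_div_two, show (2 * m + 1) / 2 = m by omega]
  · have h0 := hw ⟨m, rfl⟩
    rw [show (2 * m + 1) / 2 = m by omega] at h0
    rw [sum_range_succ, sum_range_div_two, show 2 * m / 2 = m by omega,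
      show (2 * m + 1 + 1) / 2 = m + 1 by omega, sum_range_succ, h0]
    ring

/-- Each block is one cycle of `swapPair`, split off by `invariantSum_eq_mul`. A final singleton
block has weight 0 and contributes the factor 1. -/
theorem invariantSum_swapPair {n : ℕ} {w : ℕ → ℝ} (hw : Odd n → w (n / 2) = 0) {m : ℕ}
    (hm : m ≤ (n + 1) / 2) :
    invariantSum swapPair (fun i : Fin n => w (i.val / 2)) {i | i.val / 2 < m} =
      ∏ k ∈ range m, (1 + w k ^ 2) := by
  induction m with
  | zero => simp [invariantSum, filter_singleton]
  | succ m ih =>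
    have hlt : 2 * m < n := by omega
    let a : Fin n := ⟨2 * m, hlt⟩
    have hO : ({a, swapPair a} : Finset (Fin n)).image swapPair = {a, swapPair a} := by
      simp [image_insert, swapPair_swapPair, pair_comm]
    have hdiv : ∀ i : Fin n, i ∈ ({a, swapPair a} : Finset (Fin n)) ↔ i.val / 2 = m := by
      intro i
      have := i.isLt
      simp only [mem_insert, mem_singleton, Fin.ext_iff, swapPair, a]
      split_ifs <;> omega
    have hsub : ({a, swapPair a} : Finset (Fin n)) ⊆
        univ.filter fun i : Fin n => i.val / 2 < m + 1 := by
      intro i hi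
      have := (hdiv i).1 hi
      simp [this]
    have hmin : ∀ T ⊆ ({a, swapPair a} : Finset (Fin n)), T.Nonempty → T.image swapPair = T →
        T = {a, swapPair a} := by
      intro T hT hne hTf
      refine hT.antisymm ?_
      obtain ⟨x, hx⟩ := hne
      have hx' : swapPair x ∈ T := hTf ▸ mem_image_of_mem _ hx
      have hxO := hT hx
      simp only [mem_insert, mem_singleton] at hxO
      rcases hxO with rfl | rfl
      · simp [insert_subset_iff, hx, hx']
      · rw [swapPair_swapPair] at hx'
        simp [insert_subset_iff, hx, hx']
    have hdiff : (univ.filter fun i : Fin n => i.val / 2 < m + 1) \ {a, swapPair a} =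
        univ.filter fun i : Fin n => i.val / 2 < m := by
      ext i
      rw [mem_sdiff, hdiv]
      simp only [mem_filter, mem_univ, true_and]
      omega
    have hprod : ∏ i ∈ ({a, swapPair a} : Finset (Fin n)), -w (i.val / 2) = w m ^ 2 := by
      rw [prod_congr rfl fun i hi => by rw [(hdiv i).1 hi], prod_const]
      by_cases hlast : 2 * m + 1 < n
      · have hne : a ≠ swapPair a := by
          simp only [ne_eq, Fin.ext_iff, swapPair, a]
          split_ifs <;> omega
        rw [card_pair hne, neg_sq]
      · have h0 : w m = 0 := by
          have := hw (by rw [Nat.odd_iff]; omega)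
          rwa [show n / 2 = m by omega] at this
        rw [h0, neg_zero, zero_pow two_ne_zero, zero_pow (card_pos.2 ⟨a, by simp⟩).ne']
    rw [invariantSum_eq_mul hsub hO ⟨a, by simp⟩ hmin, hdiff, ih (by omega), hprod,
      prod_range_succ]

theorem permanent_one_sub_swapPair {n : ℕ} {w : ℕ → ℝ} (hw : Odd n → w (n / 2) = 0) :
    (1 - functionMatrix swapPair fun i : Fin n => w (i.val / 2)).permanent =
      ∏ k ∈ range ((n + 1) / 2), (1 + w k ^ 2) := by
  rw [permanent_one_sub_functionMatrix, ← invariantSum_swapPair hw le_rfl]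
  congr 1
  ext i
  have := i.isLt
  simp only [mem_univ, mem_filter, true_and, true_iff]
  omega

theorem sum_blockWeight {s : ℝ} {e m : ℕ} (he : Even e) (hem : e / 2 ≤ m)
    (hs : e / 2 = m → s = e) : 2 * ∑ k ∈ range m, blockWeight s e k = s := by
  have hone : ∑ k ∈ range (e / 2), blockWeight s e k = (e : ℝ) / 2 := by
    rw [sum_congr rfl (g := fun _ => (1 : ℝ)) fun k hk => by simp [blockWeight, mem_range.1 hk]]
    simp [Nat.cast_div_charZero he.two_dvd]
  rcases hem.eq_or_lt with h | h
  -- The range ends before the partial block `e / 2`, so nothing may be left over for it.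
  · rw [← h, hone, hs h]
    ring
  · rw [← sum_subset (range_subset_range.2 (Nat.succ_le_of_lt h)), sum_range_succ, hone]
    · simp [blockWeight]
      ring
    · intro k _ hk
      simp only [mem_range, not_lt] at hk
      rw [blockWeight, if_neg (by omega), if_neg (by omega)]

theorem prod_blockWeight {s : ℝ} {e m : ℕ} (hem : e / 2 ≤ m) (hs : e / 2 = m → s = e) :
    ∏ k ∈ range m, (1 + blockWeight s e k ^ 2) = 2 ^ (e / 2) * (1 + ((s - e) / 2) ^ 2) := by
  have hone : ∏ k ∈ range (e / 2), (1 + blockWeight s e k ^ 2) = 2 ^ (e / 2) := by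
    rw [prod_congr rfl (g := fun _ => (2 : ℝ)) fun k hk => by
      simp [blockWeight, mem_range.1 hk]; norm_num]
    simp
  rcases hem.eq_or_lt with h | h
  · rw [← h, hone, hs h]
    simp
  · rw [← prod_subset (range_subset_range.2 (Nat.succ_le_of_lt h)), prod_range_succ, hone]
    · simp [blockWeight]
    · intro k _ hk
      simp only [mem_range, not_lt] at hk
      rw [blockWeight, if_neg (by omega), if_neg (by omega)]
      simp

theorem functionMatrix_swapPair_mem {n : ℕ} {s : ℝ} {r : Fin n → ℝ} (h0 : ∀ i, 0 ≤ r i)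
    (h1 : ∀ i, r i ≤ 1) (hs : ∑ i, r i = s) :
    functionMatrix swapPair r ∈ doublySubstochasticWithSum n s := by
  have hrow : ∀ i, ∑ j, functionMatrix swapPair r i j = r i := by simp [functionMatrix]
  refine ⟨⟨fun i j => ?_, fun i => (hrow i).trans_le (h1 i), fun j => ?_⟩, ?_⟩
  · simp only [functionMatrix, Matrix.of_apply]
    split_ifs
    exacts [h0 i, le_rfl]
  · have hiff : ∀ i, swapPair i = j ↔ i = swapPair j := fun i =>
      ⟨fun h => by rw [← h, swapPair_swapPair], fun h => by rw [h, swapPair_swapPair]⟩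
    simpa [functionMatrix, hiff] using h1 (swapPair j)
  · simp only [entrySum, hrow, hs]

end Extremal

/-- Maximality excludes `e + 2`, which pins `s / 2` between `e / 2` and `e / 2 + 1`. -/
theorem floorBound_half {s : ℝ} {e : ℕ} (he : IsGreatest {k : ℕ | Even k ∧ (k : ℝ) ≤ s} e) :
    s < e + 2 ∧ floorBound (s / 2) = 2 ^ (e / 2) * (1 + ((s - e) / 2) ^ 2) := by
  obtain ⟨⟨hev, hes⟩, hmax⟩ := he
  have hlt : s < e + 2 := by
    by_contra! h
    have := hmax (a := e + 2) ⟨hev.add even_two, by push_cast; exact h⟩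
    omega
  have hhalf : ((e / 2 : ℕ) : ℝ) = (e : ℝ) / 2 := Nat.cast_div_charZero hev.two_dvd
  have hf : ⌊s / 2⌋₊ = e / 2 := by
    have : (0 : ℝ) ≤ e := e.cast_nonneg
    rw [Nat.floor_eq_iff (by linarith), hhalf]
    constructor <;> linarith
  refine ⟨hlt, ?_⟩
  rw [floorBound, hf, hhalf, sub_div]

end Substochastic

theorem mainTheorem2 (n : ℕ) (s : ℝ) (hs0 : 0 ≤ s) (hsn : s ≤ (n : ℝ))
    (h : Even n ∨ (Odd n ∧ s ≤ (n : ℝ) - 1))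
    (e : ℕ) (he : IsGreatest {k : ℕ | Even k ∧ (k : ℝ) ≤ s} e) :
    IsGreatest ((fun A : Matrix (Fin n) (Fin n) ℝ => (1 - A).permanent) ''
        rowSubstochasticWithSum n s)
      ((2 : ℝ) ^ (e / 2) * (1 + ((s - (e : ℝ)) / 2) ^ 2)) ∧
    extremalMatrix n s e ∈ doublySubstochasticWithSum n s ∧
    (1 - extremalMatrix n s e).permanent =
      (2 : ℝ) ^ (e / 2) * (1 + ((s - (e : ℝ)) / 2) ^ 2) := by
  obtain ⟨hlt, hbound⟩ := floorBound_half he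
  obtain ⟨⟨hev, hes⟩, -⟩ := he
  have hen : e ≤ n := by exact_mod_cast hes.trans hsn
  -- For odd `n`, the assumption `s ≤ n - 1` ensures that a partial block of positive weight never
  -- falls on the unpaired last index.
  have hodd : Odd n → e + 1 ≤ n ∧ (e + 1 = n → s = e) := by
    intro hn
    have hs : s ≤ (n : ℝ) - 1 := (h.resolve_left (Nat.not_even_iff_odd.2 hn)).2
    constructor
    · have : (e : ℝ) + 1 ≤ n := by linarith
      exact_mod_cast this
    · intro hen1
      rw [← hen1] at hs
      push_cast at hs
      linarith
  have hev2 := Nat.even_iff.1 hev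
  have hw : Odd n → blockWeight s e (n / 2) = 0 := by
    intro hn
    obtain ⟨h1, h2⟩ := hodd hn
    rw [Nat.odd_iff] at hn
    rw [blockWeight, if_neg (by omega)]
    split_ifs with h3
    · rw [h2 (by omega), sub_self, zero_div]
    · rfl
  have hem : e / 2 ≤ (n + 1) / 2 := by omega
  have hse : e / 2 = (n + 1) / 2 → s = e := by
    intro h1
    have hn : e = n := by
      rcases Nat.even_or_odd n with hn | hn
      · rw [Nat.even_iff] at hn
        omega
      · have := (hodd hn).1
        rw [Nat.odd_iff] at hn
        omega
    refine le_antisymm ?_ hes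
    rwa [hn]
  have hmem : extremalMatrix n s e ∈ doublySubstochasticWithSum n s := by
    rw [extremalMatrix_eq hw]
    refine functionMatrix_swapPair_mem (fun i => ?_) (fun i => ?_) ?_
    · unfold blockWeight
      split_ifs <;> linarith
    · unfold blockWeight
      split_ifs <;> linarith
    · rw [sum_fin_div_two hw, sum_blockWeight hev hem hse]
  have hper : (1 - extremalMatrix n s e).permanent =
      (2 : ℝ) ^ (e / 2) * (1 + ((s - (e : ℝ)) / 2) ^ 2) := by
    rw [extremalMatrix_eq hw, permanent_one_sub_swapPair hw, prod_blockWeight hem hse]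
  refine ⟨⟨⟨_, ⟨⟨hmem.1.1, hmem.1.2.1⟩, hmem.2⟩, hper⟩, ?_⟩, hmem, hper⟩
  rintro _ ⟨A, ⟨⟨h0, h1⟩, rfl⟩, rfl⟩
  rw [← hbound]
  exact permanent_one_sub_le_floorBound h0 h1
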